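/- **Theorem (Lower bound for separable measurements).** Let $\Theta\subseteq\mathbb R^d$ be open, and let $\rho_{\theta}$, $\theta\in\Theta$, be density matrices on $\mathbb C^D$ (the output states of the probe). Fix $\theta\in\Theta$ and assume that the partial derivatives of $\rho$ at $\theta$ exist, with symmetric logarithmic derivatives $L_1,\dots,L_d$, i.e. Hermitian matrices with $\partial_j\rho_\theta=\tfrac12(\rho_\theta L_j+L_j\rho_\theta)$, and that the quantum Fisher information matrix $F_{ij}=\tfrac12\operatorname{Tr}[\rho_\theta(L_iL_j+L_jL_i)]$ is non-singular, $F>0$. For $N\ge 1$, let $\mathcal M_N^{\mathrm{(LU\text{-}S)}}$ be the set of POVMs $M=E$ on $(\mathbb C^D)^{\otimes N}$ with outcomes $\hat\theta\in\Theta$ such that * (separability) every effect $E(A)$ is a finite sum of tensor products $X_1\otimes\dots\otimes X_N$ of positive semidefinite operators; * (local unbiasedness at $\theta$) with $\mathbb E_\eta$ denoting expectation under the outcome distribution $A\mapsto\operatorname{Tr}[E(A)\rho_\eta^{\otimes N}]$, the expectation $\mathbb E_\eta[\hat\theta]$ exists for $\eta$ near $\theta$, the bias $b(\eta)=\mathbb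 E_\eta[\hat\theta]-\eta$ satisfies $b(\theta)=0$ and $\partial_jb(\theta)=0$ for all $j$, and the mean square error matrix $\Sigma_{ij}=\mathbb E_\theta[(\hat\theta_i-\theta_i)(\hat\theta_j-\theta_j)]$ is finite. Define, with values in $[0,\infty]$, $$r_N^{\mathrm s}(\theta)=\inf_{M\in\mathcal M_N^{\mathrm{(LU\text{-}S)}}}\ \sup_{0\ne G\ge0}\ \frac{N\operatorname{Tr}[G\Sigma]}{\operatorname{Tr}[GF^{-1}]},\qquad \underline r^{\mathrm s}(\theta)=\liminf_{N\to\infty}r_N^{\mathrm s}(\theta),$$ where $G$ ranges over the nonzero real symmetric positive semidefinite $d\times d$ matrices, and $\inf\emptyset=\infty$. Then $$\underline r^{\mathrm s}(\theta)\ \ge\ \frac{d}{D-1}.$$ (If $d\ge1$, then $F>0$ forces $D\ge2$; for $d=0$ the right-hand side is read as $0$.) -/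

import Mathlib

open scoped ENNReal NNReal Topology ComplexOrder

namespace SepMetrology

open MeasureTheory Matrix

/-- A density matrix: a quantum state on the Hilbert space `ℂ^ι`. -/
structure QState (ι : Type) [Fintype ι] where
  mat : Matrix ι ι ℂ
  posSemidef : mat.PosSemidef
  trace_eq_one : mat.trace = 1

/-- The tensor product `X 0 ⊗ ⋯ ⊗ X (N - 1)` of `N` operators on `ℂ^D`, an operator on
`(ℂ^D)^{⊗ N}`, whose standard basis is indexed by `Fin N → Fin D`. -/
def tensor {N D : ℕ} (X : Fin N → Matrix (Fin D) (Fin D) ℂ) :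
    Matrix (Fin N → Fin D) (Fin N → Fin D) ℂ :=
  fun a b => ∏ k, X k (a k) (b k)

theorem tensor_mul {N D : ℕ} (X Y : Fin N → Matrix (Fin D) (Fin D) ℂ) :
    tensor X * tensor Y = tensor (fun k => X k * Y k) := by
  ext a b
  simp only [tensor, Matrix.mul_apply, Finset.prod_univ_sum, Fintype.piFinset_univ,
    Finset.prod_mul_distrib]

theorem tensor_conjTranspose {N D : ℕ} (X : Fin N → Matrix (Fin D) (Fin D) ℂ) :
    (tensor X)ᴴ = tensor (fun k => (X k)ᴴ) := by
  ext a b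
  simp [tensor, Matrix.conjTranspose_apply]

theorem exists_eq_conjTranspose_mul_self {ι : Type} [Fintype ι] {A : Matrix ι ι ℂ}
    (hA : A.PosSemidef) : ∃ B : Matrix ι ι ℂ, A = Bᴴ * B := by
  classical
  open scoped MatrixOrder in
  exact CStarAlgebra.nonneg_iff_eq_star_mul_self.mp hA.nonneg

theorem tensor_posSemidef {N D : ℕ} (X : Fin N → Matrix (Fin D) (Fin D) ℂ)
    (hX : ∀ k, (X k).PosSemidef) : (tensor X).PosSemidef := by
  have h : ∀ k, ∃ B : Matrix (Fin D) (Fin D) ℂ, X k = Bᴴ * B := fun k =>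
    exists_eq_conjTranspose_mul_self (hX k)
  choose B hB using h
  have : tensor X = (tensor B)ᴴ * tensor B := by
    rw [tensor_conjTranspose, tensor_mul]
    congr 1
    funext k
    exact hB k
  rw [this]
  exact Matrix.posSemidef_conjTranspose_mul_self _

theorem tensor_trace {N D : ℕ} (X : Fin N → Matrix (Fin D) (Fin D) ℂ) :
    (tensor X).trace = ∏ k, (X k).trace := by
  simp only [Matrix.trace, Matrix.diag, tensor, Finset.prod_univ_sum, Fintype.piFinset_univ]

/-- `N` independent copies `ρ^{⊗ N}` of a state. -/
def QState.copies {D : ℕ} (ρ : QState (Fin D)) (N : ℕ) : QState (Fin N → Fin D) where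
  mat := tensor (fun _ => ρ.mat)
  posSemidef := tensor_posSemidef _ (fun _ => ρ.posSemidef)
  trace_eq_one := by rw [tensor_trace]; simp [ρ.trace_eq_one]

/-- A POVM on `ℂ^ι` with outcomes in the measurable space `Ω`: a `σ`-additive positive
operator valued measure of total mass the identity. -/
structure POVM (Ω : Type) [MeasurableSpace Ω] (ι : Type) [Fintype ι] [DecidableEq ι] where
  effect : VectorMeasure Ω (Matrix ι ι ℂ)
  posSemidef : ∀ A, MeasurableSet A → (effect A).PosSemidef
  univ_eq_one : effect Set.univ = 1

theorem re_trace_mul_nonneg {ι : Type} [Fintype ι] {E R : Matrix ι ι ℂ}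
    (hE : E.PosSemidef) (hR : R.PosSemidef) : 0 ≤ (E * R).trace.re := by
  classical
  obtain ⟨B, rfl⟩ := exists_eq_conjTranspose_mul_self hR
  have h : (E * (Bᴴ * B)).trace = (B * E * Bᴴ).trace := by
    rw [← Matrix.mul_assoc, Matrix.trace_mul_comm, ← Matrix.mul_assoc]
  rw [h]
  exact (Complex.nonneg_iff.mp (hE.mul_mul_conjTranspose_same B).trace_nonneg).1

theorem hasSum_re_trace_mul {Ω : Type} [MeasurableSpace Ω] {ι : Type} [Fintype ι]
    (E : VectorMeasure Ω (Matrix ι ι ℂ)) (R : Matrix ι ι ℂ) {f : ℕ → Set Ω}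
    (hf : ∀ i, MeasurableSet (f i)) (hd : Pairwise (Function.onFun Disjoint f)) :
    HasSum (fun i => (E (f i) * R).trace.re) (E (⋃ i, f i) * R).trace.re := by
  let φ : Matrix ι ι ℂ →+ ℝ :=
    { toFun := fun X => (X * R).trace.re
      map_zero' := by simp
      map_add' := fun X Y => by simp [Matrix.add_mul] }
  have hφ : Continuous φ := by
    change Continuous fun X : Matrix ι ι ℂ => (X * R).trace.re
    fun_prop
  exact (E.m_iUnion hf hd).map φ hφ

/-- The distribution `A ↦ Tr [E(A) ρ]` of the outcome of the measurement `M` on the state `ρ`. -/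
noncomputable def POVM.outcome {Ω : Type} [MeasurableSpace Ω] {ι : Type} [Fintype ι]
    [DecidableEq ι] (M : POVM Ω ι) (ρ : QState ι) : Measure Ω :=
  Measure.ofMeasurable (fun A _ => ENNReal.ofReal (M.effect A * ρ.mat).trace.re)
    (by simp)
    (by
      intro f hf hd
      have h := hasSum_re_trace_mul M.effect ρ.mat hf hd
      rw [← h.tsum_eq]
      exact ENNReal.ofReal_tsum_of_nonneg
        (fun i => re_trace_mul_nonneg (M.posSemidef _ (hf i)) ρ.posSemidef) h.summable)

/-- An operator on `(ℂ^D)^{⊗ N}` is separable if it is a finite sum, with nonnegative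
coefficients, of tensor products of positive semidefinite operators. -/
def IsSeparable {N D : ℕ} (E : Matrix (Fin N → Fin D) (Fin N → Fin D) ℂ) : Prop :=
  E ∈ Submodule.span ℝ≥0
    {T | ∃ X : Fin N → Matrix (Fin D) (Fin D) ℂ, (∀ k, (X k).PosSemidef) ∧ T = tensor X}

section Model

variable {d D : ℕ}

/-- The line `t ↦ θ + t e_j` through `θ` in the direction of the `j`-th parameter. -/
def shift (θ : Fin d → ℝ) (j : Fin d) (t : ℝ) : Fin d → ℝ :=
  θ + t • (Pi.single j (1 : ℝ) : Fin d → ℝ)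

/-- `L` is a symmetric logarithmic derivative of the family `ρ` for the `j`-th parameter at `θ`:
`L` is Hermitian, and `∂ρ/∂θ_j` exists and equals `(ρ L + L ρ) / 2`. -/
def IsSLD (ρ : (Fin d → ℝ) → QState (Fin D)) (θ : Fin d → ℝ) (j : Fin d)
    (L : Matrix (Fin D) (Fin D) ℂ) : Prop :=
  L.IsHermitian ∧
    ∀ a b, HasDerivAt (fun t : ℝ => (ρ (shift θ j t)).mat a b)
      (((1 / 2 : ℂ) • ((ρ θ).mat * L + L * (ρ θ).mat)) a b) 0

/-- The quantum Fisher information matrix `F_ij = ½ Tr [ρ (L_i L_j + L_j L_i)]`. -/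
noncomputable def qfi (ρ : QState (Fin D)) (L : Fin d → Matrix (Fin D) (Fin D) ℂ) :
    Matrix (Fin d) (Fin d) ℝ :=
  fun i j => 1 / 2 * (ρ.mat * (L i * L j + L j * L i)).trace.re

/-- The bias `b_i(θ) = 𝔼_θ[θ̂_i] - θ_i` of the measurement `M` on `ρ_θ^{⊗ N}`. -/
noncomputable def bias {N : ℕ} (ρ : (Fin d → ℝ) → QState (Fin D))
    (M : POVM (Fin d → ℝ) (Fin N → Fin D)) (θ : Fin d → ℝ) (i : Fin d) : ℝ :=
  (∫ x, x i ∂(M.outcome ((ρ θ).copies N))) - θ i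

/-- The mean square error matrix `Σ_ij = 𝔼_θ[(θ̂_i - θ_i) (θ̂_j - θ_j)]`. -/
noncomputable def mse {N : ℕ} (ρ : (Fin d → ℝ) → QState (Fin D))
    (M : POVM (Fin d → ℝ) (Fin N → Fin D)) (θ : Fin d → ℝ) : Matrix (Fin d) (Fin d) ℝ :=
  fun i j => ∫ x, (x i - θ i) * (x j - θ j) ∂(M.outcome ((ρ θ).copies N))

/-- Locally unbiased measurements at `θ`, with estimates in `Θ`: the expectation of the estimate
exists near `θ`, the mean square error at `θ` is finite, and the bias and all its
first partial derivatives vanish at `θ`. -/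
structure IsLocallyUnbiased {N : ℕ} (Θ : Set (Fin d → ℝ))
    (ρ : (Fin d → ℝ) → QState (Fin D)) (M : POVM (Fin d → ℝ) (Fin N → Fin D))
    (θ : Fin d → ℝ) : Prop where
  effect_compl : M.effect Θᶜ = 0
  integrable : ∀ᶠ η in 𝓝 θ, ∀ i, Integrable (fun x : Fin d → ℝ => x i)
    (M.outcome ((ρ η).copies N))
  integrable_sq : ∀ i, Integrable (fun x : Fin d → ℝ => (x i - θ i) ^ 2)
    (M.outcome ((ρ θ).copies N))
  bias_eq_zero : ∀ i, bias ρ M θ i = 0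
  deriv_bias : ∀ i j, HasDerivAt (fun t : ℝ => bias ρ M (shift θ j t) i) 0 0

/-- The set of locally unbiased separable measurements on `N` probes. -/
def LUS (Θ : Set (Fin d → ℝ)) (ρ : (Fin d → ℝ) → QState (Fin D)) (θ : Fin d → ℝ) (N : ℕ) :
    Set (POVM (Fin d → ℝ) (Fin N → Fin D)) :=
  {M | IsLocallyUnbiased Θ ρ M θ ∧ ∀ A, MeasurableSet A → IsSeparable (M.effect A)}

/-- The ratio `r_N(G, M, θ) = N Tr [G Σ] / Tr [G F⁻¹]`, where `F` is the quantum Fisher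
information matrix. -/
noncomputable def ratio {N : ℕ} (ρ : (Fin d → ℝ) → QState (Fin D))
    (F G : Matrix (Fin d) (Fin d) ℝ) (M : POVM (Fin d → ℝ) (Fin N → Fin D))
    (θ : Fin d → ℝ) : ℝ :=
  (N * (G * mse ρ M θ).trace) / (G * F⁻¹).trace

/-- `r_N^s(θ)`: the infimum over locally unbiased separable measurements of the supremum over
nonzero weight matrices `G ≥ 0` of `r_N(G, M, θ)`. -/
noncomputable def sepIncompatibilityN (Θ : Set (Fin d → ℝ)) (ρ : (Fin d → ℝ) → QState (Fin D))
    (F : Matrix (Fin d) (Fin d) ℝ) (θ : Fin d → ℝ) (N : ℕ) : ℝ≥0∞ :=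
  ⨅ M ∈ LUS Θ ρ θ N, ⨆ G ∈ {G : Matrix (Fin d) (Fin d) ℝ | G.PosSemidef ∧ G ≠ 0},
    ENNReal.ofReal (ratio ρ F G M θ)

/-- The asymptotic incompatibility figure of merit for separable measurements. -/
noncomputable def sepIncompatibility (Θ : Set (Fin d → ℝ)) (ρ : (Fin d → ℝ) → QState (Fin D))
    (F : Matrix (Fin d) (Fin d) ℝ) (θ : Fin d → ℝ) : ℝ≥0∞ :=
  Filter.liminf (fun N => sepIncompatibilityN Θ ρ F θ N) Filter.atTop

end Model

end SepMetrology

/-! This is a Gill–Massar type information bound combined with a Cramér–Rao argument, tested on the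
single weight `G = F`. For one effect `X` on one probe, Bessel's inequality and `X² ≤ (Tr X) X`
bound the squared `F`-norm of its score by `Tr X / Tr[Xρ] - 1` when `Tr[Xρ] > 0` (`exists_score`).
For a product effect the scores of the sites add up to `U`. The diagonal part of `U·FU` is
controlled site by site, and its cross terms are exactly the trace against two-site derivative
operators. Hence `(U·FU) Tr[Eρ^{⊗N}] ≤ Tr[EW]` for a fixed operator `W = informationBound`. Since
derivatives of states are traceless, the cross terms drop out of `Tr W = N(D-1)`. The left side is
not linear in `E`, so it is replaced by its lower bounds `2 z·FU - z·Fz` times the probability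
(`IsSeparable.two_mul_score_le`). These extend to sums of product effects and pass to a density of
the measurement. Taking `z = c(x - θ)` and integrating, local unbiasedness gives `2cd ≤ c² Tr[FΣ] +
N(D-1)` for all `c`. Nonpositivity of the discriminant yields `d² ≤ N(D-1) Tr[FΣ]`, which is the
claim since `Tr[F F⁻¹] = d`. -/

namespace SepMetrology

open MeasureTheory Matrix

/-! ### Matrix densities of operator valued measures -/

/-- `e` is a density of the operator valued measure `E` with respect to `μ`. -/
structure IsDensity {Ω : Type} [MeasurableSpace Ω] {ι : Type} [Fintype ι]
    (E : VectorMeasure Ω (Matrix ι ι ℂ)) (μ : Measure Ω) (e : Ω → Matrix ι ι ℂ) : Prop where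
  measurable : ∀ a b, Measurable fun x => e x a b
  integrable : ∀ a b, Integrable (fun x => e x a b) μ
  apply_eq : ∀ A, MeasurableSet A → ∀ a b, E A a b = ∫ x in A, e x a b ∂μ

/-- A finite-dimensional operator valued measure has a density with respect to some finite
measure. -/
theorem exists_density {Ω : Type} [MeasurableSpace Ω] {ι : Type} [Fintype ι]
    (E : VectorMeasure Ω (Matrix ι ι ℂ)) :
    ∃ (μ : Measure Ω) (_ : IsFiniteMeasure μ) (e : Ω → Matrix ι ι ℂ), IsDensity E μ e := by
  -- `true` selects real parts and `false` imaginary parts, so each entry yields two signed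
  -- measures.
  let φ : Bool → ι → ι → Matrix ι ι ℂ →+ ℝ := fun s a b =>
    { toFun := fun X => if s then (X a b).re else (X a b).im
      map_zero' := by cases s <;> simp
      map_add' := fun X Y => by cases s <;> simp }
  have hφ : ∀ s a b, Continuous (φ s a b) := by
    intro s a b
    cases s
    · change Continuous fun X : Matrix ι ι ℂ => (X a b).im
      fun_prop
    · change Continuous fun X : Matrix ι ι ℂ => (X a b).re
      fun_prop
  let S : Bool → ι → ι → SignedMeasure Ω := fun s a b => E.mapRange (φ s a b) (hφ s a b)
  -- This sum dominates every entry, so Radon–Nikodym applies to all of them with one reference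
  -- measure.
  let μ : Measure Ω := ∑ s, ∑ a, ∑ b, (S s a b).totalVariation
  have hfin : IsFiniteMeasure μ := by
    simp only [μ, SignedMeasure.totalVariation]
    infer_instance
  have hle : ∀ s a b, (S s a b).totalVariation ≤ μ := by
    intro s a b
    calc (S s a b).totalVariation ≤ ∑ b, (S s a b).totalVariation :=
          Finset.single_le_sum (f := fun b => (S s a b).totalVariation)
            (fun _ _ => Measure.zero_le _) (Finset.mem_univ b)
      _ ≤ ∑ a, ∑ b, (S s a b).totalVariation :=
          Finset.single_le_sum (f := fun a => ∑ b, (S s a b).totalVariation)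
            (fun _ _ => Measure.zero_le _) (Finset.mem_univ a)
      _ ≤ μ :=
          Finset.single_le_sum (f := fun s => ∑ a, ∑ b, (S s a b).totalVariation)
            (fun _ _ => Measure.zero_le _) (Finset.mem_univ s)
  have hac : ∀ s a b, VectorMeasure.AbsolutelyContinuous (S s a b) μ.toENNRealVectorMeasure :=
    fun s a b => ((S s a b).absolutelyContinuous_ennreal_iff _).2
      (by
        have h := VectorMeasure.equivMeasure.right_inv μ
        change μ.toENNRealVectorMeasure.ennrealToMeasure = μ at h
        rw [h]
        exact (hle s a b).absolutelyContinuous)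
  have hrn : ∀ s a b A, MeasurableSet A → S s a b A = ∫ x in A, (S s a b).rnDeriv μ x ∂μ := by
    intro s a b A hA
    conv_lhs => rw [← SignedMeasure.withDensityᵥ_rnDeriv_eq _ _ (hac s a b)]
    rw [withDensityᵥ_apply (SignedMeasure.integrable_rnDeriv _ _) hA]
  refine ⟨μ, hfin, fun x a b =>
    ((S true a b).rnDeriv μ x : ℂ) + ((S false a b).rnDeriv μ x : ℂ) * Complex.I, ?_, ?_, ?_⟩
  · intro a b
    have h1 := SignedMeasure.measurable_rnDeriv (S true a b) μ
    have h2 := SignedMeasure.measurable_rnDeriv (S false a b) μ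
    fun_prop
  · intro a b
    exact (SignedMeasure.integrable_rnDeriv (S true a b) μ).ofReal.add
      ((SignedMeasure.integrable_rnDeriv (S false a b) μ).ofReal.mul_const _)
  · intro A hA a b
    have hc : ∀ s, ∫ x in A, ((S s a b).rnDeriv μ x : ℂ) ∂μ = (S s a b A : ℝ) := by
      intro s
      rw [hrn s a b A hA]
      exact integral_complex_ofReal
    change E A a b = ∫ x in A, ((S true a b).rnDeriv μ x : ℂ) +
      ((S false a b).rnDeriv μ x : ℂ) * Complex.I ∂μ
    rw [integral_add (SignedMeasure.integrable_rnDeriv (S true a b) μ).integrableOn.ofReal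
      ((SignedMeasure.integrable_rnDeriv (S false a b) μ).integrableOn.ofReal.mul_const _),
      integral_mul_const, hc true, hc false]
    exact (Complex.re_add_im _).symm

namespace IsDensity

variable {Ω : Type} [MeasurableSpace Ω] {ι : Type} [Fintype ι]
  {E : VectorMeasure Ω (Matrix ι ι ℂ)} {μ : Measure Ω} {e : Ω → Matrix ι ι ℂ}

theorem measurable_trace (h : IsDensity E μ e) (H : Matrix ι ι ℂ) :
    Measurable fun x => (e x * H).trace.re := by
  have := h.measurable
  simp only [Matrix.trace, Matrix.diag, Matrix.mul_apply]
  fun_prop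

theorem integrable_trace (h : IsDensity E μ e) (H : Matrix ι ι ℂ) :
    Integrable (fun x => (e x * H).trace.re) μ := by
  simp only [Matrix.trace, Matrix.diag, Matrix.mul_apply]
  exact (integrable_finsetSum _ fun a _ => integrable_finsetSum _ fun b _ =>
    (h.integrable a b).mul_const _).re

theorem setIntegral_trace (h : IsDensity E μ e) (H : Matrix ι ι ℂ) {A : Set Ω}
    (hA : MeasurableSet A) : ∫ x in A, (e x * H).trace.re ∂μ = (E A * H).trace.re := by
  have hi : ∀ a b, Integrable (fun x => e x a b * H b a) (μ.restrict A) := fun a b =>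
    (h.integrable a b).integrableOn.mul_const _
  have h2 : ∫ x in A, (e x * H).trace ∂μ = (E A * H).trace := by
    simp only [Matrix.trace, Matrix.diag, Matrix.mul_apply]
    rw [integral_finsetSum _ fun a _ => integrable_finsetSum _ fun b _ => hi a b]
    refine Finset.sum_congr rfl fun a _ => ?_
    rw [integral_finsetSum _ fun b _ => hi a b]
    refine Finset.sum_congr rfl fun b _ => ?_
    rw [integral_mul_const, h.apply_eq A hA]
  rw [← h2]
  refine integral_re (𝕜 := ℂ) ?_
  simp only [Matrix.trace, Matrix.diag, Matrix.mul_apply]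
  exact integrable_finsetSum _ fun a _ => integrable_finsetSum _ fun b _ => hi a b

/-- Inequalities linear in the effect descend to the density in this way, since their set integrals
are nonnegative. Separability enters the density only through such inequalities. -/
theorem ae_nonneg (h : IsDensity E μ e) {H : Matrix ι ι ℂ}
    (hH : ∀ A, MeasurableSet A → 0 ≤ (E A * H).trace.re) :
    ∀ᵐ x ∂μ, 0 ≤ (e x * H).trace.re := by
  refine ae_nonneg_of_forall_setIntegral_nonneg (h.integrable_trace H) fun A hA _ => ?_
  rw [h.setIntegral_trace H hA]
  exact hH A hA

/-- One `μ` serves all states at once: the state enters only through a linear functional of `e x`,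
which later allows differentiation in the parameter. -/
theorem outcome_eq [DecidableEq ι] {M : POVM Ω ι} (h : IsDensity M.effect μ e) (ρ : QState ι) :
    M.outcome ρ = μ.withDensity fun x => ENNReal.ofReal (e x * ρ.mat).trace.re := by
  ext A hA
  rw [POVM.outcome, Measure.ofMeasurable_apply A hA, withDensity_apply _ hA,
    ← h.setIntegral_trace ρ.mat hA]
  exact ofReal_integral_eq_lintegral_ofReal (h.integrable_trace _).integrableOn
    (ae_restrict_of_ae (h.ae_nonneg fun B hB =>
      re_trace_mul_nonneg (M.posSemidef B hB) ρ.posSemidef))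

theorem integrable_outcome_iff [DecidableEq ι] {M : POVM Ω ι} (h : IsDensity M.effect μ e)
    (ρ : QState ι) (f : Ω → ℝ) :
    Integrable f (M.outcome ρ) ↔ Integrable (fun x => f x * (e x * ρ.mat).trace.re) μ := by
  rw [h.outcome_eq, integrable_withDensity_iff_integrable_smul₀'
    (h.measurable_trace _).ennreal_ofReal.aemeasurable
    (Filter.Eventually.of_forall fun _ => ENNReal.ofReal_lt_top)]
  refine integrable_congr ?_
  filter_upwards [h.ae_nonneg fun B hB =>
      re_trace_mul_nonneg (M.posSemidef B hB) ρ.posSemidef] with x hx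
  rw [ENNReal.toReal_ofReal hx, smul_eq_mul, mul_comm]

theorem integral_outcome [DecidableEq ι] {M : POVM Ω ι} (h : IsDensity M.effect μ e)
    (ρ : QState ι) (f : Ω → ℝ) :
    ∫ x, f x ∂(M.outcome ρ) = ∫ x, f x * (e x * ρ.mat).trace.re ∂μ := by
  rw [h.outcome_eq, integral_withDensity_eq_integral_toReal_smul₀
    (h.measurable_trace _).ennreal_ofReal.aemeasurable
    (Filter.Eventually.of_forall fun _ => ENNReal.ofReal_lt_top)]
  refine integral_congr_ae ?_
  filter_upwards [h.ae_nonneg fun B hB =>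
      re_trace_mul_nonneg (M.posSemidef B hB) ρ.posSemidef] with x hx
  rw [ENNReal.toReal_ofReal hx, smul_eq_mul, mul_comm]

end IsDensity

/-! ### The information inequality for one effect on one probe -/

/-- The real linear functional `Y ↦ Re Tr [E Y]`. -/
noncomputable def reTrace {ι : Type} [Fintype ι] (E : Matrix ι ι ℂ) : Matrix ι ι ℂ →ₗ[ℝ] ℝ where
  toFun Y := (E * Y).trace.re
  map_add' Y Z := by simp [Matrix.mul_add]
  map_smul' c Y := by simp

theorem reTrace_apply {ι : Type} [Fintype ι] (E Y : Matrix ι ι ℂ) :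
    reTrace E Y = (E * Y).trace.re := rfl

theorem reTrace_comm {ι : Type} [Fintype ι] (E Y : Matrix ι ι ℂ) :
    reTrace E Y = reTrace Y E := by
  rw [reTrace_apply, reTrace_apply, Matrix.trace_mul_comm]

/-- Conjugating the trace reverses the product, and cyclicity restores it. Reality matters because
real parts do not commute with the product over sites in `reTrace_tensor`. -/
theorem ofReal_reTrace {ι : Type} [Fintype ι] {E Y : Matrix ι ι ℂ} (hE : E.IsHermitian)
    (hY : Y.IsHermitian) : ((reTrace E Y : ℝ) : ℂ) = (E * Y).trace := by
  rw [reTrace_apply, ← Complex.conj_eq_iff_re, starRingEnd_apply, ← Matrix.trace_conjTranspose,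
    Matrix.conjTranspose_mul, hE.eq, hY.eq, Matrix.trace_mul_comm]

section SingleProbe

variable {ι : Type} [Fintype ι]

theorem reTrace_self_conjTranspose (A : Matrix ι ι ℂ) :
    reTrace Aᴴ A = ∑ a, ∑ b, ‖A a b‖ ^ 2 := by
  rw [reTrace_apply, Matrix.trace, Finset.sum_comm]
  simp [Matrix.mul_apply, Complex.sq_norm, Complex.normSq_apply]

theorem sum_norm_sq_mul_le (A B : Matrix ι ι ℂ) :
    ∑ a, ∑ b, ‖(A * B) a b‖ ^ 2 ≤ (∑ a, ∑ b, ‖A a b‖ ^ 2) * ∑ a, ∑ b, ‖B a b‖ ^ 2 := by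
  have h : ∀ a b, ‖(A * B) a b‖ ^ 2 ≤ (∑ c, ‖A a c‖ ^ 2) * ∑ c, ‖B c b‖ ^ 2 := by
    intro a b
    calc ‖(A * B) a b‖ ^ 2 ≤ (∑ c, ‖A a c‖ * ‖B c b‖) ^ 2 := by
          rw [Matrix.mul_apply]
          gcongr
          exact (norm_sum_le _ _).trans_eq (by simp)
      _ ≤ _ := Finset.sum_mul_sq_le_sq_mul_sq _ _ _
  rw [Finset.sum_comm (f := fun a b => ‖B a b‖ ^ 2), Finset.sum_mul_sum]
  exact Finset.sum_le_sum fun a _ => Finset.sum_le_sum fun b _ => h a b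

/-- This is `X² ≤ (Tr X) X`, as eigenvalues of `X` are at most its trace. With `R = CᴴC` and `X =
BᴴB` it becomes submultiplicativity of the Frobenius norm for `Bᴴ` and `BCᴴ`. -/
theorem reTrace_mul_self_le {R X : Matrix ι ι ℂ} (hR : R.PosSemidef) (hX : X.PosSemidef) :
    reTrace R (X * X) ≤ X.trace.re * reTrace R X := by
  obtain ⟨C, rfl⟩ := exists_eq_conjTranspose_mul_self hR
  obtain ⟨B, rfl⟩ := exists_eq_conjTranspose_mul_self hX
  have h1 : reTrace (Cᴴ * C) (Bᴴ * B * (Bᴴ * B)) = ∑ a, ∑ b, ‖(Bᴴ * (B * Cᴴ)) a b‖ ^ 2 := by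
    rw [← reTrace_self_conjTranspose, reTrace_apply, reTrace_apply, Matrix.mul_assoc,
      Matrix.trace_mul_comm]
    simp [Matrix.conjTranspose_mul, Matrix.mul_assoc]
  have h2 : reTrace (Cᴴ * C) (Bᴴ * B) = ∑ a, ∑ b, ‖(B * Cᴴ) a b‖ ^ 2 := by
    rw [← reTrace_self_conjTranspose, reTrace_apply, reTrace_apply, Matrix.mul_assoc,
      Matrix.trace_mul_comm]
    simp [Matrix.conjTranspose_mul, Matrix.mul_assoc]
  have h3 : (Bᴴ * B).trace.re = ∑ a, ∑ b, ‖Bᴴ a b‖ ^ 2 := by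
    rw [← reTrace_self_conjTranspose, reTrace_apply, Matrix.conjTranspose_conjTranspose,
      Matrix.trace_mul_comm]
  rw [h1, h2, h3]
  exact sum_norm_sq_mul_le _ _

variable [DecidableEq ι]

/-- Bessel's inequality for the orthogonal observables `1` and `S`. -/
theorem reTrace_anticomm_le (ρ : QState ι) {X S : Matrix ι ι ℂ} (hX : X.IsHermitian)
    (hS : S.IsHermitian) (h0 : reTrace ρ.mat S = 0) :
    reTrace ρ.mat (X * S + S * X) ≤
      reTrace ρ.mat (X * X) - reTrace ρ.mat X ^ 2 + reTrace ρ.mat (S * S) := by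
  set p := reTrace ρ.mat X with hp
  -- The residual of `X` after removing its mean and `S`; the claim is the expansion of `Re Tr[ρA²]
  -- ≥ 0`.
  let A : Matrix ι ι ℂ := X - p • 1 - S
  have hA : A.IsHermitian := by
    refine (hX.sub ?_).sub hS
    simp [Matrix.IsHermitian, Matrix.conjTranspose_smul]
  have h1 : 0 ≤ reTrace ρ.mat (A * A) := by
    have := re_trace_mul_nonneg ρ.posSemidef (Matrix.posSemidef_conjTranspose_mul_self A)
    rwa [hA.eq] at this
  have h2 : A * A = X * X + S * S + (p * p) • 1 - (X * S + S * X) - (2 * p) • X + (2 * p) • S := by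
    simp only [A, Matrix.sub_mul, Matrix.mul_sub, Matrix.smul_mul, Matrix.mul_smul, Matrix.one_mul,
      Matrix.mul_one]
    module
  have h3 : reTrace ρ.mat 1 = 1 := by simp [reTrace_apply, ρ.trace_eq_one]
  rw [h2, map_add, map_sub, map_sub, map_add, map_add, map_smul, map_smul, map_smul, h0, h3,
    ← hp] at h1
  simp only [smul_eq_mul] at h1
  linarith

end SingleProbe

section Quadratic

variable {n : Type} [Fintype n]

/-- Expands the form at `z - u`. It trades the quadratic term in the score for one linear in it. -/
theorem two_mul_dotProduct_mulVec_le {F : Matrix n n ℝ} (hF : F.PosSemidef) (z u : n → ℝ) :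
    2 * (z ⬝ᵥ F *ᵥ u) ≤ z ⬝ᵥ F *ᵥ z + u ⬝ᵥ F *ᵥ u := by
  have h := hF.dotProduct_mulVec_nonneg (z - u)
  have hs : u ⬝ᵥ F *ᵥ z = z ⬝ᵥ F *ᵥ u := by
    rw [Matrix.dotProduct_mulVec, ← Matrix.mulVec_transpose, dotProduct_comm]
    congr 2
    simpa using hF.1.eq
  simp only [star_trivial, Matrix.mulVec_sub, sub_dotProduct, dotProduct_sub] at h
  linarith

end Quadratic

/-- The derivative of a state with symmetric logarithmic derivative `L`. -/
noncomputable def sldDeriv {D : ℕ} (ρ : QState (Fin D)) (L : Matrix (Fin D) (Fin D) ℂ) :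
    Matrix (Fin D) (Fin D) ℂ :=
  (1 / 2 : ℂ) • (ρ.mat * L + L * ρ.mat)

section Single

variable {d D : ℕ} (ρ : QState (Fin D)) (L : Fin d → Matrix (Fin D) (Fin D) ℂ)

theorem sldDeriv_isHermitian {L : Matrix (Fin D) (Fin D) ℂ} (hL : L.IsHermitian) :
    (sldDeriv ρ L).IsHermitian := by
  simp [sldDeriv, Matrix.IsHermitian, Matrix.conjTranspose_smul, hL.eq, ρ.posSemidef.1.eq, add_comm]

theorem reTrace_sldDeriv (X L : Matrix (Fin D) (Fin D) ℂ) :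
    reTrace X (sldDeriv ρ L) = 1 / 2 * reTrace ρ.mat (X * L + L * X) := by
  have h1 : (X * (ρ.mat * L)).trace = (ρ.mat * (L * X)).trace := by
    rw [Matrix.trace_mul_comm, Matrix.mul_assoc]
  have h2 : (X * (L * ρ.mat)).trace = (ρ.mat * (X * L)).trace := by
    rw [← Matrix.mul_assoc, Matrix.trace_mul_comm]
  simp only [reTrace_apply, sldDeriv, Matrix.mul_smul, Matrix.trace_smul, Matrix.mul_add,
    Matrix.trace_add, h1, h2]
  have : (1 / 2 : ℂ) = ((1 / 2 : ℝ) : ℂ) := by norm_num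
  rw [this, smul_eq_mul, Complex.re_ofReal_mul, add_comm]

theorem reTrace_sum_smul_mul_self (w : Fin d → ℝ) :
    reTrace ρ.mat ((∑ j, w j • L j) * ∑ j, w j • L j) = w ⬝ᵥ qfi ρ L *ᵥ w := by
  have h : ∀ i j, qfi ρ L i j = 1 / 2 * (reTrace ρ.mat (L i * L j) + reTrace ρ.mat (L j * L i)) := by
    intro i j
    rw [← map_add]
    rfl
  have h1 : reTrace ρ.mat ((∑ j, w j • L j) * ∑ j, w j • L j) =
      ∑ i, ∑ j, w i * w j * reTrace ρ.mat (L i * L j) := by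
    rw [Finset.sum_mul_sum]
    simp only [map_sum, Matrix.smul_mul, Matrix.mul_smul, map_smul, smul_eq_mul]
    exact Finset.sum_congr rfl fun i _ => Finset.sum_congr rfl fun j _ => by ring
  have h2 : ∑ i, ∑ j, w i * w j * reTrace ρ.mat (L i * L j) =
      ∑ i, ∑ j, w i * w j * reTrace ρ.mat (L j * L i) := by
    rw [Finset.sum_comm]
    exact Finset.sum_congr rfl fun i _ => Finset.sum_congr rfl fun j _ => by ring
  have h3 : w ⬝ᵥ qfi ρ L *ᵥ w = 1 / 2 * (∑ i, ∑ j, w i * w j * reTrace ρ.mat (L i * L j)) +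
      1 / 2 * ∑ i, ∑ j, w i * w j * reTrace ρ.mat (L j * L i) := by
    simp only [dotProduct, Matrix.mulVec, h, Finset.mul_sum, ← Finset.sum_add_distrib]
    exact Finset.sum_congr rfl fun i _ => Finset.sum_congr rfl fun j _ => by ring
  rw [h1, h3, ← h2]
  ring

/-- The information inequality for a single effect `X`: the classical score of the outcome `X`
has norm at most `Tr X - Tr [X ρ]` with respect to the quantum Fisher information. -/
theorem exists_score {ρ : QState (Fin D)} {L : Fin d → Matrix (Fin D) (Fin D) ℂ}
    (hL : ∀ j, (L j).IsHermitian) (hL0 : ∀ j, reTrace ρ.mat (L j) = 0)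
    (hF : (qfi ρ L).PosDef) {X : Matrix (Fin D) (Fin D) ℂ} (hX : X.PosSemidef) :
    ∃ u : Fin d → ℝ,
      (∀ j, reTrace X (sldDeriv ρ (L j)) = (qfi ρ L *ᵥ u) j * reTrace X ρ.mat) ∧
      (1 + u ⬝ᵥ qfi ρ L *ᵥ u) * reTrace X ρ.mat ≤ reTrace X 1 := by
  set F := qfi ρ L with hFdef
  set p := reTrace X ρ.mat with hp
  let q : Fin d → ℝ := fun j => reTrace X (sldDeriv ρ (L j))
  let w := F⁻¹ *ᵥ q
  have hdet : IsUnit F.det := hF.isUnit.map Matrix.detMonoidHom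
  have hFw : F *ᵥ w = q := by
    simp [w, Matrix.mulVec_mulVec, Matrix.mul_nonsing_inv _ hdet]
  have hX1 : reTrace X 1 = X.trace.re := by simp [reTrace_apply]
  have hp0 : 0 ≤ p := re_trace_mul_nonneg hX ρ.posSemidef
  have hX0 : 0 ≤ X.trace.re := (Complex.nonneg_iff.mp hX.trace_nonneg).1
  have hbound : w ⬝ᵥ F *ᵥ w ≤ p * (X.trace.re - p) := by
    -- With `w = F⁻¹q`, the anticommutator term equals `2 w·Fw` and the variance of `S` equals
    -- `w·Fw`, so Bessel leaves `w·Fw ≤ Tr[ρX²] - p²`.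
    let S := ∑ j, w j • L j
    have hS : S.IsHermitian := by
      simp only [S, Matrix.IsHermitian, Matrix.conjTranspose_sum, Matrix.conjTranspose_smul,
        star_trivial, (hL _).eq]
    have hS0 : reTrace ρ.mat S = 0 := by simp [S, hL0]
    have h1 := reTrace_anticomm_le ρ hX.1 hS hS0
    have h2 : reTrace ρ.mat (X * S + S * X) = 2 * (w ⬝ᵥ F *ᵥ w) := by
      rw [hFw]
      simp only [dotProduct, q, reTrace_sldDeriv, S, Finset.mul_sum, Finset.sum_mul,
        ← Finset.sum_add_distrib, map_sum, Matrix.mul_smul, Matrix.smul_mul, ← smul_add, map_smul,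
        smul_eq_mul]
      exact Finset.sum_congr rfl fun j _ => by ring
    have h3 := reTrace_sum_smul_mul_self ρ L w
    have h4 := reTrace_mul_self_le ρ.posSemidef hX
    rw [h2, h3, reTrace_comm _ X] at h1
    rw [reTrace_comm _ X] at h4
    simp only [← hFdef, ← hp] at h1 h4
    nlinarith
  rcases hp0.eq_or_lt with h | h
  -- An outcome of probability zero has zero derivative too, by the bound, so the score may be taken
  -- to be `0`; otherwise it is `w / p`.
  · have hw : w = 0 := by
      by_contra hne
      have := hF.dotProduct_mulVec_pos hne
      rw [← h, zero_mul] at hbound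
      simp only [star_trivial] at this
      linarith
    refine ⟨0, fun j => ?_, ?_⟩
    · change q j = _
      rw [← hFw, hw]
      simp
    · rw [hX1, ← h]
      simpa using hX0
  · refine ⟨p⁻¹ • w, fun j => ?_, ?_⟩
    · rw [Matrix.mulVec_smul, hFw, Pi.smul_apply, smul_eq_mul, mul_comm _ p,
        mul_inv_cancel_left₀ h.ne']
    · rw [hX1, Matrix.mulVec_smul, dotProduct_smul, smul_dotProduct, smul_eq_mul, smul_eq_mul]
      have : (1 + p⁻¹ * (p⁻¹ * (w ⬝ᵥ F *ᵥ w))) * p = p + (w ⬝ᵥ F *ᵥ w) / p := by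
        field_simp
      rw [this]
      have h5 : (w ⬝ᵥ F *ᵥ w) / p ≤ X.trace.re - p := by
        rw [div_le_iff₀ h]
        linarith
      linarith

end Single

/-! ### Product effects and one- and two-site operators -/

section Tensor

variable {N D : ℕ}

/-- The sum over `k` of the operators with `Y` at site `k` and `R` at the other sites. -/
def siteSum (N : ℕ) (R Y : Matrix (Fin D) (Fin D) ℂ) :
    Matrix (Fin N → Fin D) (Fin N → Fin D) ℂ :=
  ∑ k : Fin N, tensor (Function.update (fun _ => R) k Y)

/-- The sum over ordered pairs `k ≠ l` of the operators with `Y` at site `k`, `Z` at site `l`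
and `R` at the other sites. -/
def pairSum (N : ℕ) (R Y Z : Matrix (Fin D) (Fin D) ℂ) :
    Matrix (Fin N → Fin D) (Fin N → Fin D) ℂ :=
  ∑ k : Fin N, ∑ l ∈ Finset.univ.erase k,
    tensor (Function.update (Function.update (fun _ => R) k Y) l Z)

theorem reTrace_tensor {X Y : Fin N → Matrix (Fin D) (Fin D) ℂ} (hX : ∀ k, (X k).IsHermitian)
    (hY : ∀ k, (Y k).IsHermitian) :
    reTrace (tensor X) (tensor Y) = ∏ k, reTrace (X k) (Y k) := by
  rw [reTrace_apply, tensor_mul, tensor_trace]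
  simp only [← ofReal_reTrace (hX _) (hY _), ← Complex.ofReal_prod, Complex.ofReal_re]

theorem isHermitian_update {Y : Fin N → Matrix (Fin D) (Fin D) ℂ} (hY : ∀ k, (Y k).IsHermitian)
    (k : Fin N) {Z : Matrix (Fin D) (Fin D) ℂ} (hZ : Z.IsHermitian) (l : Fin N) :
    (Function.update Y k Z l).IsHermitian := by
  rcases eq_or_ne l k with rfl | h
  · simpa using hZ
  · simpa [h] using hY l

theorem reTrace_tensor_update {X Y : Fin N → Matrix (Fin D) (Fin D) ℂ}
    (hX : ∀ k, (X k).IsHermitian) (hY : ∀ k, (Y k).IsHermitian) (k : Fin N)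
    {Z : Matrix (Fin D) (Fin D) ℂ} (hZ : Z.IsHermitian) :
    reTrace (tensor X) (tensor (Function.update Y k Z)) =
      reTrace (X k) Z * ∏ l ∈ Finset.univ.erase k, reTrace (X l) (Y l) := by
  rw [reTrace_tensor hX (isHermitian_update hY k hZ),
    ← Finset.mul_prod_erase _ _ (Finset.mem_univ k), Function.update_self]
  congr 1
  refine Finset.prod_congr rfl fun l hl => ?_
  rw [Function.update_of_ne (Finset.ne_of_mem_erase hl)]

theorem reTrace_tensor_update_of_eq {X Y : Fin N → Matrix (Fin D) (Fin D) ℂ}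
    (hX : ∀ k, (X k).IsHermitian) (hY : ∀ k, (Y k).IsHermitian) (k : Fin N)
    {Z : Matrix (Fin D) (Fin D) ℂ} (hZ : Z.IsHermitian) {s : ℝ}
    (hs : reTrace (X k) Z = s * reTrace (X k) (Y k)) :
    reTrace (tensor X) (tensor (Function.update Y k Z)) =
      s * reTrace (tensor X) (tensor Y) := by
  rw [reTrace_tensor_update hX hY k hZ, reTrace_tensor hX hY, hs,
    ← Finset.mul_prod_erase _ _ (Finset.mem_univ k), mul_assoc]

theorem le_reTrace_tensor_update {X Y : Fin N → Matrix (Fin D) (Fin D) ℂ}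
    (hX : ∀ k, (X k).IsHermitian) (hY : ∀ k, (Y k).IsHermitian)
    (hXY : ∀ k, 0 ≤ reTrace (X k) (Y k)) (k : Fin N)
    {Z : Matrix (Fin D) (Fin D) ℂ} (hZ : Z.IsHermitian) {s : ℝ}
    (hs : s * reTrace (X k) (Y k) ≤ reTrace (X k) Z) :
    s * reTrace (tensor X) (tensor Y) ≤
      reTrace (tensor X) (tensor (Function.update Y k Z)) := by
  rw [reTrace_tensor_update hX hY k hZ, reTrace_tensor hX hY,
    ← Finset.mul_prod_erase _ _ (Finset.mem_univ k), ← mul_assoc]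
  exact mul_le_mul_of_nonneg_right hs (Finset.prod_nonneg fun l _ => hXY l)

theorem trace_siteSum {R : Matrix (Fin D) (Fin D) ℂ} (hR : R.trace = 1)
    (Y : Matrix (Fin D) (Fin D) ℂ) : (siteSum N R Y).trace = N * Y.trace := by
  have h : ∀ k : Fin N, (tensor (Function.update (fun _ => R) k Y)).trace = Y.trace := by
    intro k
    rw [tensor_trace, ← Finset.mul_prod_erase _ _ (Finset.mem_univ k), Function.update_self,
      Finset.prod_eq_one, mul_one]
    intro l hl
    rw [Function.update_of_ne (Finset.ne_of_mem_erase hl), hR]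
  simp [siteSum, Matrix.trace_sum, h]

theorem trace_pairSum (R Y : Matrix (Fin D) (Fin D) ℂ) {Z : Matrix (Fin D) (Fin D) ℂ}
    (hZ : Z.trace = 0) : (pairSum N R Y Z).trace = 0 := by
  simp only [pairSum, Matrix.trace_sum, tensor_trace]
  refine Finset.sum_eq_zero fun k _ => Finset.sum_eq_zero fun l _ => ?_
  exact Finset.prod_eq_zero (Finset.mem_univ l) (by simpa using hZ)

end Tensor

/-! ### The information bound for separable effects -/

section Bound

variable {d D : ℕ}

/-- The operator whose expectation bounds the classical Fisher information of a separable
measurement on `N` probes, relative to the quantum Fisher information of one probe. -/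
noncomputable def informationBound (N : ℕ) (ρ : QState (Fin D))
    (L : Fin d → Matrix (Fin D) (Fin D) ℂ) : Matrix (Fin N → Fin D) (Fin N → Fin D) ℂ :=
  siteSum N ρ.mat 1 - (N : ℝ) • (ρ.copies N).mat +
    ∑ i, ∑ j, (qfi ρ L)⁻¹ i j • pairSum N ρ.mat (sldDeriv ρ (L i)) (sldDeriv ρ (L j))

/-- The identity at one site gives `N * D`, the copies remove `N`, and two-site terms are traceless:
this is the source of `D - 1`. -/
theorem trace_informationBound (N : ℕ) (ρ : QState (Fin D))
    {L : Fin d → Matrix (Fin D) (Fin D) ℂ} (h0 : ∀ j, (sldDeriv ρ (L j)).trace = 0) :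
    (informationBound N ρ L).trace = N * ((D : ℂ) - 1) := by
  simp only [informationBound, Matrix.trace_add, Matrix.trace_sub, Matrix.trace_smul,
    Matrix.trace_sum, trace_siteSum ρ.trace_eq_one, (ρ.copies N).trace_eq_one,
    trace_pairSum _ _ (h0 _), Matrix.trace_one, Fintype.card_fin]
  simp
  ring

/-- The inequality between the score and the information bound, linearized so that it is linear
in the effect `E`. -/
theorem IsSeparable.two_mul_score_le {N : ℕ} {ρ : QState (Fin D)}
    {L : Fin d → Matrix (Fin D) (Fin D) ℂ} (hL : ∀ j, (L j).IsHermitian)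
    (hL0 : ∀ j, reTrace ρ.mat (L j) = 0) (hF : (qfi ρ L).PosDef)
    {E : Matrix (Fin N → Fin D) (Fin N → Fin D) ℂ} (hE : IsSeparable E) (z : Fin d → ℝ) :
    2 * ∑ j, z j * reTrace E (siteSum N ρ.mat (sldDeriv ρ (L j))) ≤
      (z ⬝ᵥ qfi ρ L *ᵥ z) * reTrace E (ρ.copies N).mat + reTrace E (informationBound N ρ L) := by
  induction hE using Submodule.span_induction with
  | zero => simp [reTrace_apply]
  | add E E' _ _ h h' =>
    have hadd : ∀ Y, reTrace (E + E') Y = reTrace E Y + reTrace E' Y := fun Y => by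
      rw [reTrace_comm, map_add, reTrace_comm Y, reTrace_comm Y]
    simp only [hadd, mul_add, Finset.sum_add_distrib]
    linarith
  | smul c E _ h =>
    have hsmul : ∀ Y, reTrace (c • E) Y = c * reTrace E Y := fun Y => by
      rw [reTrace_comm, reTrace_comm E, ← smul_eq_mul, ← map_smul]
      rfl
    simp only [hsmul]
    calc _ = (c : ℝ) * (2 * ∑ j, z j * reTrace E (siteSum N ρ.mat (sldDeriv ρ (L j)))) := by
          simp only [Finset.mul_sum]
          exact Finset.sum_congr rfl fun j _ => by ring
      _ ≤ _ := mul_le_mul_of_nonneg_left h c.2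
      _ = _ := by ring
  | mem E hE =>
    obtain ⟨X, hX, rfl⟩ := hE
    set F := qfi ρ L with hFdef
    have hdet : IsUnit F.det := hF.isUnit.map Matrix.detMonoidHom
    choose u hu hu1 using fun k => exists_score hL hL0 hF (hX k)
    have hXh : ∀ k, (X k).IsHermitian := fun k => (hX k).1
    have hρh : ∀ _ : Fin N, ρ.mat.IsHermitian := fun _ => ρ.posSemidef.1
    have hdh : ∀ j, (sldDeriv ρ (L j)).IsHermitian := fun j => sldDeriv_isHermitian ρ (hL j)
    set b := reTrace (tensor X) (tensor fun _ => ρ.mat) with hb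
    have hb0 : 0 ≤ b := re_trace_mul_nonneg (tensor_posSemidef X hX) (ρ.copies N).posSemidef
    -- Logarithmic derivatives of a product add, so `U` is the score of the product effect.
    set U := ∑ k, u k with hU
    have hscore : ∀ j, reTrace (tensor X) (siteSum N ρ.mat (sldDeriv ρ (L j))) =
        (F *ᵥ U) j * b := by
      intro j
      simp only [siteSum, map_sum, hU, Matrix.mulVec_sum, Finset.sum_apply, Finset.sum_mul]
      exact Finset.sum_congr rfl fun k _ =>
        reTrace_tensor_update_of_eq hXh hρh k (hdh j) (hu k j)
    have hone : ∑ k, (1 + u k ⬝ᵥ F *ᵥ u k) * b ≤ reTrace (tensor X) (siteSum N ρ.mat 1) := by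
      simp only [siteSum, map_sum]
      exact Finset.sum_le_sum fun k _ => le_reTrace_tensor_update hXh hρh
        (fun l => re_trace_mul_nonneg (hX l) ρ.posSemidef) k Matrix.isHermitian_one (hu1 k)
    have hpair : ∀ i j, reTrace (tensor X)
        (pairSum N ρ.mat (sldDeriv ρ (L i)) (sldDeriv ρ (L j))) =
        ∑ k, ∑ l ∈ Finset.univ.erase k, (F *ᵥ u k) i * (F *ᵥ u l) j * b := by
      intro i j
      simp only [pairSum, map_sum]
      refine Finset.sum_congr rfl fun k _ => Finset.sum_congr rfl fun l hl => ?_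
      rw [reTrace_tensor_update_of_eq hXh (isHermitian_update hρh k (hdh i)) l (hdh j)
        (s := (F *ᵥ u l) j), reTrace_tensor_update_of_eq hXh hρh k (hdh i) (hu k i)]
      · ring
      · rw [Function.update_of_ne (Finset.ne_of_mem_erase hl)]
        exact hu l j
    have hinv : ∀ k l, ∑ i, ∑ j, F⁻¹ i j * ((F *ᵥ u k) i * (F *ᵥ u l) j) =
        u k ⬝ᵥ F *ᵥ u l := by
      intro k l
      have h1 : ∀ v w : Fin d → ℝ, ∑ i, ∑ j, F⁻¹ i j * (v i * w j) = v ⬝ᵥ F⁻¹ *ᵥ w := by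
        intro v w
        simp only [dotProduct, Matrix.mulVec, Finset.mul_sum]
        exact Finset.sum_congr rfl fun i _ => Finset.sum_congr rfl fun j _ => by ring
      rw [h1, Matrix.mulVec_mulVec, Matrix.nonsing_inv_mul _ hdet, Matrix.one_mulVec,
        ← Matrix.vecMul_transpose, ← Matrix.dotProduct_mulVec]
      congr 2
      simpa using hF.1.eq
    have hcross : ∑ i, ∑ j, F⁻¹ i j * reTrace (tensor X)
        (pairSum N ρ.mat (sldDeriv ρ (L i)) (sldDeriv ρ (L j))) =
        ∑ k, ∑ l ∈ Finset.univ.erase k, (u k ⬝ᵥ F *ᵥ u l) * b := by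
      simp only [hpair, ← hinv, Finset.mul_sum, Finset.sum_mul]
      refine ((Finset.sum_congr rfl fun i _ => Finset.sum_comm.trans
        (Finset.sum_congr rfl fun k _ => Finset.sum_comm)).trans
        (Finset.sum_comm.trans (Finset.sum_congr rfl fun k _ => Finset.sum_comm))).trans ?_
      exact Finset.sum_congr rfl fun k _ => Finset.sum_congr rfl fun l _ =>
        Finset.sum_congr rfl fun i _ => Finset.sum_congr rfl fun j _ => by ring
    have hUU : U ⬝ᵥ F *ᵥ U = ∑ k, (u k ⬝ᵥ F *ᵥ u k) +
        ∑ k, ∑ l ∈ Finset.univ.erase k, u k ⬝ᵥ F *ᵥ u l := by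
      rw [← Finset.sum_add_distrib, hU, Matrix.mulVec_sum, sum_dotProduct]
      refine Finset.sum_congr rfl fun k _ => ?_
      rw [dotProduct_sum, Finset.add_sum_erase _ (fun l => u k ⬝ᵥ F *ᵥ u l) (Finset.mem_univ k)]
    -- The diagonal of `U·FU` costs an inequality, from `hone`; the off-diagonal terms are matched
    -- exactly by `hcross`.
    have hW : (U ⬝ᵥ F *ᵥ U) * b ≤ reTrace (tensor X) (informationBound N ρ L) := by
      simp only [informationBound, map_add, map_sub, map_smul, map_sum, smul_eq_mul, ← hFdef]
      rw [hcross, hUU]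
      change _ ≤ _ - N * b + _
      simp only [add_mul, Finset.sum_add_distrib, one_mul, Finset.sum_const, Finset.card_univ,
        Fintype.card_fin, nsmul_eq_mul, Finset.sum_mul] at hone ⊢
      linarith
    have hz := two_mul_dotProduct_mulVec_le hF.posSemidef z U
    calc _ = 2 * (z ⬝ᵥ F *ᵥ U) * b := by
          simp only [hscore, dotProduct, Finset.mul_sum, Finset.sum_mul]
          exact Finset.sum_congr rfl fun j _ => by ring
      _ ≤ (z ⬝ᵥ F *ᵥ z + U ⬝ᵥ F *ᵥ U) * b := mul_le_mul_of_nonneg_right hz hb0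
      _ = (z ⬝ᵥ F *ᵥ z) * b + (U ⬝ᵥ F *ᵥ U) * b := add_mul _ _ _
      _ ≤ _ := add_le_add le_rfl hW

end Bound

/-! ### Differentiating expectations at the true parameter -/

/-- A linear functional on a subspace of a finite-dimensional space commutes with derivatives of
curves in that subspace. -/
theorem exists_hasDerivAt_of_eventually_mem {E : Type*} [NormedAddCommGroup E] [NormedSpace ℝ E]
    [FiniteDimensional ℝ E] {V : Submodule ℝ E} (φ : V →ₗ[ℝ] ℝ) {R : ℝ → E} {R' : E} {t : ℝ}
    (hR : HasDerivAt R R' t) (hV : ∀ᶠ s in 𝓝 t, R s ∈ V) {f : ℝ → ℝ}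
    (hf : ∀ᶠ s in 𝓝 t, ∀ h : R s ∈ V, f s = φ ⟨R s, h⟩) :
    ∃ h : R' ∈ V, HasDerivAt f (φ ⟨R', h⟩) t := by
  have hmem : R' ∈ V := by
    have hcl : IsClosed (V : Set E) := V.closed_of_finiteDimensional
    refine hcl.mem_of_tendsto hR.tendsto_slope ?_
    filter_upwards [hV.filter_mono nhdsWithin_le_nhds] with s hs
    rw [slope_def_module]
    exact V.smul_mem _ (V.sub_mem hs hV.self_of_nhds)
  -- A linear extension to the whole finite-dimensional space is automatically continuous, so it can
  -- be composed with the derivative.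
  obtain ⟨ψ, hψ⟩ := LinearMap.exists_extend φ
  have hψ' : ∀ x (h : x ∈ V), ψ x = φ ⟨x, h⟩ := fun x h => by
    rw [← hψ]
    rfl
  refine ⟨hmem, ?_⟩
  rw [← hψ']
  have h1 : HasDerivAt (fun s => ψ.toContinuousLinearMap (R s)) (ψ.toContinuousLinearMap R') t :=
    ψ.toContinuousLinearMap.hasFDerivAt.comp_hasDerivAt t hR
  refine h1.congr_of_eventuallyEq ?_
  filter_upwards [hV, hf] with s hs hfs
  rw [hfs hs]
  exact (hψ' _ hs).symm

section Model

variable {d D : ℕ} {ρ : (Fin d → ℝ) → QState (Fin D)} {θ : Fin d → ℝ} {j : Fin d}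
  {L : Matrix (Fin D) (Fin D) ℂ}

@[simp]
theorem shift_zero (θ : Fin d → ℝ) (j : Fin d) : shift θ j 0 = θ := by
  simp [shift]

theorem continuous_shift (θ : Fin d → ℝ) (j : Fin d) : Continuous (shift θ j) := by
  unfold shift
  fun_prop

theorem IsSLD.trace_sldDeriv (h : IsSLD ρ θ j L) : (sldDeriv (ρ θ) L).trace = 0 := by
  have h1 : HasDerivAt (fun t : ℝ => ∑ a, (ρ (shift θ j t)).mat a a)
      (∑ a, sldDeriv (ρ θ) L a a) 0 :=
    HasDerivAt.fun_sum fun a _ => h.2 a a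
  have h2 : (fun t : ℝ => ∑ a, (ρ (shift θ j t)).mat a a) = fun _ => 1 :=
    funext fun t => (ρ (shift θ j t)).trace_eq_one
  rw [h2] at h1
  exact h1.unique (hasDerivAt_const _ _)

/-- By cyclicity the left side is the trace of the state's derivative, and the trace of a state is
constant. -/
theorem IsSLD.reTrace_eq_zero (h : IsSLD ρ θ j L) : reTrace (ρ θ).mat L = 0 := by
  have h1 := reTrace_sldDeriv (ρ θ) 1 L
  have h2 : reTrace (1 : Matrix (Fin D) (Fin D) ℂ) (sldDeriv (ρ θ) L) = 0 := by
    rw [reTrace_apply, Matrix.one_mul, h.trace_sldDeriv, Complex.zero_re]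
  rw [h2, Matrix.one_mul, Matrix.mul_one, map_add] at h1
  linarith

theorem IsSLD.hasDerivAt_copies (h : IsSLD ρ θ j L) (N : ℕ) (a b : Fin N → Fin D) :
    HasDerivAt (fun t : ℝ => ((ρ (shift θ j t)).copies N).mat a b)
      (siteSum N (ρ θ).mat (sldDeriv (ρ θ) L) a b) 0 := by
  have h1 := HasDerivAt.fun_finsetProd (u := Finset.univ)
    (f := fun (k : Fin N) (t : ℝ) => (ρ (shift θ j t)).mat (a k) (b k))
    (f' := fun k => sldDeriv (ρ θ) L (a k) (b k)) (x := 0) fun k _ => h.2 (a k) (b k)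
  refine h1.congr_deriv ?_
  rw [siteSum, Matrix.sum_apply]
  refine Finset.sum_congr rfl fun k _ => ?_
  rw [tensor, ← Finset.mul_prod_erase _ _ (Finset.mem_univ k), Function.update_self, smul_eq_mul,
    mul_comm]
  congr 1
  refine Finset.prod_congr rfl fun l hl => ?_
  rw [Function.update_of_ne (Finset.ne_of_mem_erase hl), shift_zero]

attribute [local instance] Matrix.normedAddCommGroup Matrix.normedSpace

/-- A locally unbiased measurement has score-weighted first moments `δ_ij`, and these exist. -/
theorem IsLocallyUnbiased.integral_mul_score {N : ℕ} {Θ : Set (Fin d → ℝ)}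
    {M : POVM (Fin d → ℝ) (Fin N → Fin D)} (hM : IsLocallyUnbiased Θ ρ M θ)
    {μ : Measure (Fin d → ℝ)} {e : (Fin d → ℝ) → Matrix (Fin N → Fin D) (Fin N → Fin D) ℂ}
    (he : IsDensity M.effect μ e) (hL : IsSLD ρ θ j L) (i : Fin d) :
    Integrable (fun x => (x i - θ i) * reTrace (e x) (siteSum N (ρ θ).mat (sldDeriv (ρ θ) L))) μ ∧
    ∫ x, (x i - θ i) * reTrace (e x) (siteSum N (ρ θ).mat (sldDeriv (ρ θ) L)) ∂μ =
      (Pi.single j (1 : ℝ) : Fin d → ℝ) i := by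
  set R' := siteSum N (ρ θ).mat (sldDeriv (ρ θ) L) with hR'
  -- The operators against which `x i` is integrable form a finite-dimensional space containing the
  -- states near `θ`. Their derivative then lies in it too, and no dominated convergence is needed.
  let V : Submodule ℝ (Matrix (Fin N → Fin D) (Fin N → Fin D) ℂ) :=
    { carrier := {H | Integrable (fun x => x i * reTrace (e x) H) μ}
      zero_mem' := by simp
      add_mem' := fun {H K} hH hK => by
        simp only [Set.mem_ofPred_eq, map_add, mul_add] at *
        exact hH.add hK
      smul_mem' := fun c H hH => by
        simp only [Set.mem_ofPred_eq, map_smul, smul_eq_mul, mul_left_comm _ c] at *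
        exact hH.const_mul c }
  let φ : V →ₗ[ℝ] ℝ :=
    { toFun := fun H => ∫ x, x i * reTrace (e x) H.1 ∂μ
      map_add' := fun H K => by
        simp only [Submodule.coe_add, map_add, mul_add]
        exact integral_add H.2 K.2
      map_smul' := fun c H => by
        simp only [Submodule.coe_smul, map_smul, smul_eq_mul, mul_left_comm _ c,
          integral_const_mul, RingHom.id_apply] }
  have hR : HasDerivAt (fun t : ℝ => ((ρ (shift θ j t)).copies N).mat) R' 0 :=
    hasDerivAt_pi.2 fun a => hasDerivAt_pi.2 fun b => hL.hasDerivAt_copies N a b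
  have hV : ∀ᶠ t in 𝓝 (0 : ℝ), ((ρ (shift θ j t)).copies N).mat ∈ V := by
    have ht : Filter.Tendsto (shift θ j) (𝓝 0) (𝓝 θ) := by
      simpa using (continuous_shift θ j).tendsto 0
    filter_upwards [ht.eventually hM.integrable] with t h
    exact (he.integrable_outcome_iff _ _).1 (h i)
  obtain ⟨hmem, hder⟩ := exists_hasDerivAt_of_eventually_mem φ hR hV
    (f := fun t => ∫ x, x i ∂(M.outcome ((ρ (shift θ j t)).copies N)))
    (Filter.Eventually.of_forall fun t _ => he.integral_outcome _ _)
  have hder' : HasDerivAt (fun t => ∫ x, x i ∂(M.outcome ((ρ (shift θ j t)).copies N)))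
      ((Pi.single j (1 : ℝ) : Fin d → ℝ) i) 0 := by
    have h1 : HasDerivAt (fun t => shift θ j t i) ((Pi.single j (1 : ℝ) : Fin d → ℝ) i) 0 := by
      simpa [shift] using
        ((hasDerivAt_id (0 : ℝ)).mul_const ((Pi.single j (1 : ℝ) : Fin d → ℝ) i)).const_add (θ i)
    have h2 := (hM.deriv_bias i j).add h1
    rw [zero_add] at h2
    refine h2.congr_of_eventuallyEq (Filter.Eventually.of_forall fun t => ?_)
    simp [bias]
  have hint := he.integrable_trace R'
  -- The total score vanishes, so centering `x i` at `θ i` does not change the moment.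
  have hzero : ∫ x, reTrace (e x) R' ∂μ = 0 := by
    have h1 := he.setIntegral_trace R' MeasurableSet.univ
    rw [setIntegral_univ, M.univ_eq_one, Matrix.one_mul, hR',
      trace_siteSum (ρ θ).trace_eq_one, hL.trace_sldDeriv] at h1
    exact h1.trans (by simp)
  simp only [sub_mul]
  refine ⟨Integrable.sub hmem (hint.const_mul _), ?_⟩
  have h3 := integral_sub (show Integrable (fun x => x i * reTrace (e x) R') μ from hmem)
    (show Integrable (fun x => θ i * reTrace (e x) R') μ from hint.const_mul _)
  rw [h3, integral_const_mul, hzero, mul_zero, sub_zero]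
  exact hder.unique hder'

/-- The entries of the mean square error matrix exist. -/
theorem IsLocallyUnbiased.integrable_mul {N : ℕ} {Θ : Set (Fin d → ℝ)}
    {M : POVM (Fin d → ℝ) (Fin N → Fin D)} (hM : IsLocallyUnbiased Θ ρ M θ) (i j : Fin d) :
    Integrable (fun x : Fin d → ℝ => (x i - θ i) * (x j - θ j))
      (M.outcome ((ρ θ).copies N)) := by
  have h : ∀ i, MemLp (fun x : Fin d → ℝ => x i - θ i) 2 (M.outcome ((ρ θ).copies N)) :=
    fun i => (memLp_two_iff_integrable_sq
      ((measurable_pi_apply i).sub_const _).aestronglyMeasurable).2 (hM.integrable_sq i)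
  exact (h i).integrable_mul (h j)

end Model

/-! ### The Cramér–Rao step -/

/-- The combined information and Cramér-Rao inequalities for separable measurements. -/
theorem sq_le_trace_mul_mse {d D N : ℕ} {Θ : Set (Fin d → ℝ)}
    {ρ : (Fin d → ℝ) → QState (Fin D)} {θ : Fin d → ℝ} {L : Fin d → Matrix (Fin D) (Fin D) ℂ}
    (hL : ∀ j, IsSLD ρ θ j (L j)) (hF : (qfi (ρ θ) L).PosDef)
    {M : POVM (Fin d → ℝ) (Fin N → Fin D)} (hM : M ∈ LUS Θ ρ θ N) :
    (d : ℝ) ^ 2 ≤ (qfi (ρ θ) L * mse ρ M θ).trace * (N * ((D : ℝ) - 1)) := by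
  obtain ⟨hU, hS⟩ := hM
  obtain ⟨μ, -, e, he⟩ := exists_density M.effect
  set F := qfi (ρ θ) L with hFdef
  set W := informationBound N (ρ θ) L with hW
  let R : Fin d → Matrix (Fin N → Fin D) (Fin N → Fin D) ℂ := fun j =>
    siteSum N (ρ θ).mat (sldDeriv (ρ θ) (L j))
  let R₀ := ((ρ θ).copies N).mat
  have hpt : ∀ᵐ x ∂μ, ∀ z : Fin d → ℝ, 2 * ∑ j, z j * reTrace (e x) (R j) ≤
      (z ⬝ᵥ F *ᵥ z) * reTrace (e x) R₀ + reTrace (e x) W := by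
    -- Later `z` depends on `x`, so one null set must serve all `z`: rational vectors suffice, by
    -- density and continuity.
    have h1 : ∀ q : Fin d → ℚ, ∀ᵐ x ∂μ, 2 * ∑ j, (q j : ℝ) * reTrace (e x) (R j) ≤
        ((fun j => (q j : ℝ)) ⬝ᵥ F *ᵥ (fun j => (q j : ℝ))) * reTrace (e x) R₀ +
          reTrace (e x) W := by
      intro q
      set z : Fin d → ℝ := fun j => (q j : ℝ) with hz
      have hlin : ∀ X, reTrace X ((z ⬝ᵥ F *ᵥ z) • R₀ + W - (2 : ℝ) • ∑ j, z j • R j) =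
          (z ⬝ᵥ F *ᵥ z) * reTrace X R₀ + reTrace X W - 2 * ∑ j, z j * reTrace X (R j) := by
        intro X
        simp only [map_add, map_sub, map_smul, map_sum, smul_eq_mul]
      filter_upwards [he.ae_nonneg (H := (z ⬝ᵥ F *ᵥ z) • R₀ + W - (2 : ℝ) • ∑ j, z j • R j)
        fun A hA => by
          rw [← reTrace_apply, hlin]
          exact sub_nonneg.2 ((hS A hA).two_mul_score_le (fun j => (hL j).1)
            (fun j => (hL j).reTrace_eq_zero) hF z)] with x hx
      rw [← reTrace_apply, hlin] at hx
      exact sub_nonneg.1 hx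
    filter_upwards [ae_all_iff.2 h1] with x hx z
    have hdense : DenseRange fun (q : Fin d → ℚ) (j : Fin d) => (q j : ℝ) :=
      DenseRange.piMap fun _ => Rat.denseRange_cast
    refine hdense.induction_on (p := fun z : Fin d → ℝ =>
      2 * ∑ j, z j * reTrace (e x) (R j) ≤
      (z ⬝ᵥ F *ᵥ z) * reTrace (e x) R₀ + reTrace (e x) W) z ?_ hx
    refine isClosed_le (by fun_prop) ?_
    simp only [dotProduct, Matrix.mulVec]
    fun_prop
  let y : (Fin d → ℝ) → Fin d → ℝ := fun x j => x j - θ j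
  have hscore := fun j => hU.integral_mul_score he (hL j) j
  have hmse : ∀ i j, Integrable (fun x => y x i * y x j * reTrace (e x) R₀) μ ∧
      ∫ x, y x i * y x j * reTrace (e x) R₀ ∂μ = mse ρ M θ i j := fun i j =>
    ⟨(he.integrable_outcome_iff _ _).1 (hU.integrable_mul i j), (he.integral_outcome _ _).symm⟩
  have hquad : ∀ x, (y x ⬝ᵥ F *ᵥ y x) * reTrace (e x) R₀ =
      ∑ i, ∑ j, F i j * (y x i * y x j * reTrace (e x) R₀) := by
    intro x
    simp only [dotProduct, Matrix.mulVec, Finset.mul_sum, Finset.sum_mul]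
    exact Finset.sum_congr rfl fun i _ => Finset.sum_congr rfl fun j _ => by ring
  have hrow : ∀ i, Integrable (fun x => ∑ j, F i j * (y x i * y x j * reTrace (e x) R₀)) μ :=
    fun i => integrable_finsetSum _ fun j _ => (hmse i j).1.const_mul _
  have hint1 : Integrable (fun x => ∑ j, y x j * reTrace (e x) (R j)) μ :=
    integrable_finsetSum _ fun j _ => (hscore j).1
  have hint2 : Integrable (fun x => (y x ⬝ᵥ F *ᵥ y x) * reTrace (e x) R₀) μ := by
    simp only [hquad]
    exact integrable_finsetSum _ fun i _ => hrow i
  have hint3 : Integrable (fun x => reTrace (e x) W) μ := he.integrable_trace W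
  have hI1 : ∫ x, ∑ j, y x j * reTrace (e x) (R j) ∂μ = d := by
    rw [integral_finsetSum _ fun j _ => (hscore j).1]
    exact (Finset.sum_congr rfl fun j _ => (hscore j).2).trans (by simp)
  have hI2 : ∫ x, (y x ⬝ᵥ F *ᵥ y x) * reTrace (e x) R₀ ∂μ = (F * mse ρ M θ).trace := by
    simp only [hquad]
    rw [integral_finsetSum _ fun i _ => hrow i]
    simp only [Matrix.trace, Matrix.diag, Matrix.mul_apply]
    refine Finset.sum_congr rfl fun i _ => ?_
    rw [integral_finsetSum _ fun j _ => (hmse i j).1.const_mul _]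
    refine Finset.sum_congr rfl fun j _ => ?_
    rw [integral_const_mul, (hmse i j).2]
    congr 1
    exact integral_congr_ae (Filter.Eventually.of_forall fun x => mul_comm _ _)
  have hI3 : ∫ x, reTrace (e x) W ∂μ = N * ((D : ℝ) - 1) := by
    have h1 := he.setIntegral_trace W MeasurableSet.univ
    rw [setIntegral_univ, M.univ_eq_one, Matrix.one_mul, hW,
      trace_informationBound N (ρ θ) fun j => (hL j).trace_sldDeriv] at h1
    refine h1.trans ?_
    have : (N * ((D : ℂ) - 1)) = ((N * ((D : ℝ) - 1) : ℝ) : ℂ) := by push_cast; rfl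
    rw [this, Complex.ofReal_re]
  have hmain : ∀ c : ℝ, 0 ≤ (F * mse ρ M θ).trace * (c * c) + (-(2 * d)) * c +
      N * ((D : ℝ) - 1) := by
    intro c
    have h1 : ∫ x, (2 * c) * ∑ j, y x j * reTrace (e x) (R j) ∂μ ≤
        ∫ x, (c * c) * ((y x ⬝ᵥ F *ᵥ y x) * reTrace (e x) R₀) + reTrace (e x) W ∂μ := by
      refine integral_mono_ae (hint1.const_mul _) ((hint2.const_mul _).add hint3) ?_
      filter_upwards [hpt] with x hx
      -- The test vector is the scaled estimation error; the free scale `c` makes the integrated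
      -- bound a quadratic polynomial.
      have h2 := hx (c • y x)
      simp only [Pi.smul_apply, smul_eq_mul, Matrix.mulVec_smul, dotProduct_smul, smul_dotProduct,
        mul_assoc, ← Finset.mul_sum] at h2 ⊢
      exact h2
    rw [integral_const_mul, integral_add (hint2.const_mul _) hint3, integral_const_mul, hI1, hI2,
      hI3] at h1
    linarith
  have := discrim_le_zero hmain
  rw [discrim] at this
  linarith

end SepMetrology

/-! ### The asymptotic lower bound -/

theorem mainTheorem4 (d D : ℕ) (Θ : Set (Fin d → ℝ)) (hΘ : IsOpen Θ)
    (ρ : (Fin d → ℝ) → SepMetrology.QState (Fin D)) (θ : Fin d → ℝ) (hθ : θ ∈ Θ)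
    (L : Fin d → Matrix (Fin D) (Fin D) ℂ)
    (hL : ∀ j, SepMetrology.IsSLD ρ θ j (L j))
    (hF : (SepMetrology.qfi (ρ θ) L).PosDef) :
    (d : ℝ≥0∞) / ((D : ℝ≥0∞) - 1) ≤
      SepMetrology.sepIncompatibility Θ ρ (SepMetrology.qfi (ρ θ) L) θ := by
  rcases Nat.eq_zero_or_pos d with rfl | hd
  -- The left side is `0` even if `D = 1`, as `0 / 0 = 0` in `ℝ≥0∞`.
  · simp
  have hd' : (0 : ℝ) < d := Nat.cast_pos.2 hd
  refine Filter.le_liminf_of_le (by isBoundedDefault) ?_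
  filter_upwards [Filter.eventually_ge_atTop 1] with N hN
  refine le_iInf₂ fun M hM => ?_
  set F := SepMetrology.qfi (ρ θ) L
  have hdet : IsUnit F.det := hF.isUnit.map Matrix.detMonoidHom
  have hN' : (0 : ℝ) < N := Nat.cast_pos.2 hN
  have hD : 1 ≤ D := by
    rcases Nat.eq_zero_or_pos D with rfl | h
    · simpa [Matrix.trace] using (ρ θ).trace_eq_one
    · exact h
  have hF0 : F ≠ 0 := by
    rintro h0
    have : Nonempty (Fin d) := ⟨⟨0, hd⟩⟩
    rw [h0, Matrix.det_zero] at hdet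
    exact not_isUnit_zero hdet
  -- The supremum is bounded below by the weight `G = F`, whose denominator is `Tr 1 = d`.
  refine le_trans ?_ (le_iSup₂ (f := fun G (_ : G ∈ {G : Matrix (Fin d) (Fin d) ℝ |
    G.PosSemidef ∧ G ≠ 0}) => ENNReal.ofReal (SepMetrology.ratio ρ F G M θ)) F
    ⟨hF.posSemidef, hF0⟩)
  have hkey := SepMetrology.sq_le_trace_mul_mse hL hF hM
  have hD1 : (0 : ℝ) < (D : ℝ) - 1 := by
    have h0 : (0 : ℝ) ≤ (D : ℝ) - 1 := sub_nonneg.2 (by exact_mod_cast hD)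
    refine h0.lt_of_ne' fun h => ?_
    -- If `D = 1`, the key inequality would read `d² ≤ 0`.
    rw [h, mul_zero, mul_zero] at hkey
    nlinarith
  have hcast : (d : ℝ≥0∞) / ((D : ℝ≥0∞) - 1) = ENNReal.ofReal (d / ((D : ℝ) - 1)) := by
    rw [ENNReal.ofReal_div_of_pos hD1, ENNReal.ofReal_sub _ zero_le_one]
    simp
  rw [hcast]
  refine ENNReal.ofReal_le_ofReal ?_
  rw [SepMetrology.ratio, Matrix.mul_nonsing_inv _ hdet, Matrix.trace_one, Fintype.card_fin,
    div_le_div_iff₀ hD1 hd']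
  linarith
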